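/- Let $d,n,m\ge 1$ be integers, $D>0$, $\epsilon>0$, and let $\mathcal{X}_\infty=\{u\in\mathbb{R}^d:\|u\|_\infty\le D\}$. There are $n$ users; user $i$ holds $\mathbf{X}_i=(\mathbf{X}_{i1},\dots,\mathbf{X}_{im})$, where all the $\mathbf{X}_{ij}$ are i.i.d. with distribution $p$ on $\mathcal{X}_\infty$ and mean $\mu=\mathbb{E}[\mathbf{X}_{ij}]$. A mechanism $M$ with values in a measurable space $\mathcal{Z}$ releases $\mathbf{Z}_1,\dots,\mathbf{Z}_n\in\mathcal{Z}$ sequentially: $\mathbf{Z}_i$ is drawn from a conditional distribution that depends on $\mathbf{X}_i$ and on $\mathbf{Z}_1,\dots,\mathbf{Z}_{i-1}$. It is user-level $\epsilon$-LDP if for all $i$, all $z_1,\dots,z_{i-1}\in\mathcal{Z}$, all $x,x'\in\mathcal{X}_\infty^m$ and all measurable $S\subseteq\mathcal{Z}$, $$\mathrm{P}(\mathbf{Z}_i\in S\mid \mathbf{X}_i=x,\mathbf{Z}_{1:i-1}=z_{1:i-1})\le e^{\epsilon}\,\mathrm{P}(\mathbf{Z}_i\in S\mid \mathbf{X}_i=x',\mathbf{Z}_{1:i-1}=z_{1:i-1}).$$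 Let $\mathcal{M}_\epsilon$ be the set of these mechanisms and $\mathcal{P}_{\mathcal{X},\infty}$ the set of all probability distributions on $\mathcal{X}_\infty$. Then there is a universal constant $c>0$ (independent of $d,n,m,D,\epsilon$ and $\mathcal{Z}$) such that $$\inf_{\hat\mu}\ \inf_{M\in\mathcal{M}_\epsilon}\ \sup_{p\in\mathcal{P}_{\mathcal{X},\infty}}\ \mathbb{E}\left[\|\hat\mu(\mathbf{Z}_1,\dots,\mathbf{Z}_n)-\mu\|_2^2\right]\ \ge\ c\,\min\left\{\frac{D^2d^2}{nm\,(\epsilon^2\wedge\epsilon)},\ D^2d\right\},$$ where the first infimum is over all measurable $\hat\mu:\mathcal{Z}^n\to\mathbb{R}^d$. In particular, the minimax risk is at least $c\,D^2d^2/(nm(\epsilon^2\wedge\epsilon))$ whenever $nm(\epsilon^2\wedge\epsilon)\ge d$. -/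

import Mathlib

open MeasureTheory ProbabilityTheory
open scoped ENNReal

namespace UserLDP

universe u v

/-- The `ℓ∞` ball `{u ∈ ℝ^d : ‖u‖_∞ ≤ D}`, inside `ℝ^d` with its Euclidean norm. -/
def linftyBall (d : ℕ) (D : ℝ) : Set (EuclideanSpace ℝ (Fin d)) :=
  {u | ∀ k, |u k| ≤ D}

/-- A sequentially interactive privacy mechanism for `n` users with `m` samples each: user `i`
draws `Z_i` from a distribution that depends on the local data set `X_i ∈ 𝒳^m` and on the
previously released values `Z_0, …, Z_{i-1}`. -/
structure Mechanism (𝒳 : Type v) (𝒵 : Type u) [MeasurableSpace 𝒳] [MeasurableSpace 𝒵]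
    (n m : ℕ) where
  /-- The conditional law of `Z_i` given the data of user `i` and the earlier releases. -/
  channel : (i : Fin n) → Kernel ((Fin m → 𝒳) × (Fin i → 𝒵)) 𝒵
  isMarkov : ∀ i, IsMarkovKernel (channel i)

namespace Mechanism

variable {𝒳 : Type v} {𝒵 : Type u} [MeasurableSpace 𝒳] [MeasurableSpace 𝒵] {n m : ℕ}

/-- User-level `ε`-local differential privacy: replacing the whole local data set of a user changes
the conditional probability of every event by a factor of at most `e^ε`. -/
def IsUserLDP (M : Mechanism 𝒳 𝒵 n m) (ε : ℝ) : Prop :=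
  ∀ (i : Fin n) (z : Fin i → 𝒵) (x x' : Fin m → 𝒳) (S : Set 𝒵), MeasurableSet S →
    M.channel i (x, z) S ≤ ENNReal.ofReal (Real.exp ε) * M.channel i (x', z) S

/-- The channel of user `i`, as a kernel from all data and the earlier releases. -/
noncomputable def step (M : Mechanism 𝒳 𝒵 n m) (i : Fin n) :
    Kernel ((Fin n → Fin m → 𝒳) × (Fin i → 𝒵)) 𝒵 :=
  (M.channel i).comap (fun p => (p.1 i, p.2)) (by fun_prop)

/-- The conditional law of the first `k` releases, given the data of all users. -/
noncomputable def transcript (M : Mechanism 𝒳 𝒵 n m) :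
    (k : ℕ) → k ≤ n → Kernel (Fin n → Fin m → 𝒳) (Fin k → 𝒵)
  | 0, _ => Kernel.const _ (Measure.dirac Fin.elim0)
  | k + 1, h =>
      (M.transcript k (Nat.le_of_succ_le h) ⊗ₖ M.step ⟨k, h⟩).map
        (fun p => Fin.snoc (α := fun _ => 𝒵) p.1 p.2)

/-- The law of `(Z_0, …, Z_{n-1})` when all `n * m` samples are i.i.d. with distribution `P`. -/
noncomputable def law (M : Mechanism 𝒳 𝒵 n m) (P : Measure 𝒳) : Measure (Fin n → 𝒵) :=
  (Measure.pi fun _ : Fin n => Measure.pi fun _ : Fin m => P).bind (M.transcript n le_rfl)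

end Mechanism

/-- The mean vector of a distribution on the `ℓ∞` ball. -/
noncomputable def mean {d : ℕ} {D : ℝ} (P : Measure (linftyBall d D)) :
    EuclideanSpace ℝ (Fin d) :=
  ∫ x, (x : EuclideanSpace ℝ (Fin d)) ∂P

/-- The mean squared error `E ‖μ̂(Z) - μ‖₂²` of the estimator `est` when the samples have
distribution `P` and are privatized by `M`. -/
noncomputable def mse {d : ℕ} {D : ℝ} {𝒵 : Type u} [MeasurableSpace 𝒵] {n m : ℕ}
    (est : (Fin n → 𝒵) → EuclideanSpace ℝ (Fin d)) (M : Mechanism (linftyBall d D) 𝒵 n m)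
    (P : Measure (linftyBall d D)) : ℝ≥0∞ :=
  ∫⁻ z, ENNReal.ofReal (‖est z - mean P‖ ^ 2) ∂(M.law P)

/-- The minimax risk: infimum over all estimators and all user-level `ε`-LDP mechanisms with
outputs in `𝒵` of the worst mean squared error over all distributions on the `ℓ∞` ball. -/
noncomputable def minimaxRisk (d : ℕ) (D : ℝ) (n m : ℕ) (ε : ℝ) (𝒵 : Type u)
    [MeasurableSpace 𝒵] : ℝ≥0∞ :=
  ⨅ (est : (Fin n → 𝒵) → EuclideanSpace ℝ (Fin d)) (_ : Measurable est)
    (M : Mechanism (linftyBall d D) 𝒵 n m) (_ : M.IsUserLDP ε),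
    ⨆ P : ProbabilityMeasure (linftyBall d D), mse est M (P : Measure (linftyBall d D))

end UserLDP

/-! Restrict the data to the vertices `{±D}^d` with independent coordinates of mean `D θ_l`, where
`θ` ranges over `[-1,1]^d`; after rescaling by `D` it suffices to show that `θ` is hard to estimate.
Put the uniform prior on the cube. Integrating by parts with the weight `1 - θ_l²`, which kills the
boundary terms and cancels the denominator of the score of a sign, shows that the error `θ̂ - θ` has
mean inner product `2d/3` with `S - 2θ`, where `S` is the sum of all centered signs
(`exists_two_mul_div_three_le_sum_score`). Hence at some `θ`, with risk `R`, `2d/3 ≤ E⟨θ̂ - θ, S⟩ -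
2 E⟨θ̂ - θ, θ⟩`. By Cauchy–Schwarz the square of the last expectation is at most `d R`.

Privacy bounds the other one. The score of one user is sub-Gaussian with proxy `m` in every
direction, and conditioning on an `ε`-private output tilts its law by a density in `[e^{-ε}, e^ε]`.
The conditional mean of the score therefore has squared norm at most `8 m (ε² ∧ ε)`, with no factor
`d` (`sum_sq_tilted_mean_le`). Contributions of successive users add up by a martingale-type
decomposition (`sq_sum_integral_transcript_le`), so `(E⟨θ̂ - θ, S⟩)² ≤ 8 n m (ε² ∧ ε) R`. Together,
`(2d/3)² ≤ (16 n m (ε² ∧ ε) + 8 d) R`. -/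

namespace UserLDP

/-! ### Sub-Gaussian scores and the effect of a bounded tilt. -/

/-- A centered vector-valued score on a finite probability space all of whose linear functionals
are sub-Gaussian with variance proxy `v`. -/
structure IsSubgaussianScore {A ι : Type*} [Fintype A] [Fintype ι] (p : A → ℝ) (s : A → ι → ℝ)
    (v : ℝ) : Prop where
  nonneg : ∀ a, 0 ≤ p a
  sum_eq_one : ∑ a, p a = 1
  centered : ∀ l, ∑ a, p a * s a l = 0
  mgf_le : ∀ c : ι → ℝ,
    ∑ a, p a * Real.exp (∑ l, c l * s a l) ≤ Real.exp (v * (∑ l, c l ^ 2) / 2)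

namespace IsSubgaussianScore

variable {A ι : Type*} [Fintype A] [Fintype ι] {p : A → ℝ} {s : A → ι → ℝ} {v : ℝ}

lemma second_moment_le (h : IsSubgaussianScore p s v) (hv : 0 < v) (c : ι → ℝ) :
    ∑ a, p a * (∑ l, c l * s a l) ^ 2 ≤ 2 * (v * ∑ l, c l ^ 2) := by
  set Y : A → ℝ := fun a => ∑ l, c l * s a l with hY
  have key : ∀ t : ℝ, t ^ 2 * ∑ a, p a * Y a ^ 2
      ≤ 2 * (Real.exp (t ^ 2 * (v * ∑ l, c l ^ 2) / 2) - 1) := by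
    intro t
    have h1 := h.mgf_le (fun l => t * c l)
    have h2 := h.mgf_le (fun l => -t * c l)
    have e1 : ∀ a, ∑ l, t * c l * s a l = t * Y a := fun a => by
      simp only [hY, Finset.mul_sum, mul_assoc]
    have e2 : ∀ a, ∑ l, -t * c l * s a l = -(t * Y a) := fun a => by
      simp only [hY, Finset.mul_sum, mul_assoc, ← Finset.sum_neg_distrib, neg_mul]
    simp only [e1, e2, mul_pow, neg_sq, ← Finset.mul_sum] at h1 h2
    have e3 : v * (t ^ 2 * ∑ l, c l ^ 2) / 2 = t ^ 2 * (v * ∑ l, c l ^ 2) / 2 := by ring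
    rw [e3] at h1 h2
    -- From `cosh y = 1 + 2 sinh² (y/2)` and `|sinh u| ≥ |u|`.
    have h3 : ∀ y : ℝ, 2 + y ^ 2 ≤ Real.exp y + Real.exp (-y) := fun y => by
      have h0 : |y / 2| ≤ |Real.sinh (y / 2)| := by
        rw [Real.abs_sinh]
        exact Real.self_le_sinh_iff.2 (abs_nonneg _)
      have h1 := sq_le_sq.2 h0
      have h2 := Real.cosh_two_mul (y / 2)
      rw [Real.cosh_sq, mul_div_cancel₀ y two_ne_zero, Real.cosh_eq] at h2
      linarith
    have h4 : ∑ a, p a * (2 + (t * Y a) ^ 2)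
        ≤ ∑ a, (p a * Real.exp (t * Y a) + p a * Real.exp (-(t * Y a))) :=
      Finset.sum_le_sum fun a _ => by
        rw [← mul_add]
        exact mul_le_mul_of_nonneg_left (h3 _) (h.nonneg a)
    have h5 : ∑ a, p a * (2 + (t * Y a) ^ 2) = 2 + t ^ 2 * ∑ a, p a * Y a ^ 2 := by
      rw [Finset.mul_sum]
      simp only [mul_add, Finset.sum_add_distrib, ← Finset.sum_mul, h.sum_eq_one, one_mul]
      congr 1
      exact Finset.sum_congr rfl fun a _ => by ring
    rw [Finset.sum_add_distrib] at h4
    linarith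
  have hC : 0 ≤ v * ∑ l, c l ^ 2 := mul_nonneg hv.le (Finset.sum_nonneg fun _ _ => sq_nonneg _)
  set C := v * ∑ l, c l ^ 2
  rcases hC.eq_or_lt with h0 | hpos
  · have := key 1
    rw [← h0] at this
    simp at this
    rw [← h0]
    linarith
  -- This choice of `t` turns the exponent into `1/2`, and `e^{1/2} - 1 ≤ 1`.
  · have := key (√C)⁻¹
    rw [inv_pow, Real.sq_sqrt hpos.le, inv_mul_cancel₀ hpos.ne'] at this
    have h6 : Real.exp (1 / 2) - 1 ≤ 1 := by
      have := Real.abs_exp_sub_one_le (x := 1 / 2) (by norm_num)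
      rw [abs_le] at this
      have := this.2
      norm_num at this ⊢
      linarith
    have h7 : C⁻¹ * ∑ a, p a * Y a ^ 2 ≤ 2 := by linarith
    rwa [inv_mul_le_iff₀ hpos, mul_comm] at h7

/-- Test the score along its own tilted mean `τ`, so that dimension never enters. For large `ε`
Jensen and the moment generating function bound suffice; for small `ε`, centering replaces `g` by `g
- 1 = O(ε)` and the second moment suffices. -/
lemma sum_sq_tilted_mean_le (h : IsSubgaussianScore p s v) (hv : 0 < v) {ε : ℝ} (hε : 0 < ε)
    {g : A → ℝ} (hg : ∑ a, p a * g a = 1) (hle : ∀ a, g a ≤ Real.exp ε)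
    (hge : ∀ a, Real.exp (-ε) ≤ g a) :
    ∑ l, (∑ a, p a * g a * s a l) ^ 2 ≤ 8 * v * min (ε ^ 2) ε := by
  set τ : ι → ℝ := fun l => ∑ a, p a * g a * s a l with hτ
  set T := ∑ l, τ l ^ 2 with hT
  have hT0 : 0 ≤ T := Finset.sum_nonneg fun _ _ => sq_nonneg _
  have hg0 : ∀ a, 0 ≤ g a := fun a => (Real.exp_pos _).le.trans (hge a)
  have hTeq : T = ∑ a, p a * g a * ∑ l, τ l * s a l := by
    simp only [hT, Finset.mul_sum]
    rw [Finset.sum_comm]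
    refine Finset.sum_congr rfl fun l _ => ?_
    rw [sq, hτ]
    simp only [Finset.mul_sum]
    exact Finset.sum_congr rfl fun a _ => by ring
  -- Jensen in the direction `τ / v` gives `T/v ≤ ε + T/(2v)`.
  have hlarge : T ≤ 2 * v * ε := by
    have hJ := convexOn_exp.map_sum_le (t := Finset.univ) (w := fun a => p a * g a)
      (p := fun a => ∑ l, τ l / v * s a l) (fun a _ => mul_nonneg (h.nonneg a) (hg0 a)) hg
      (fun _ _ => Set.mem_univ _)
    simp only [smul_eq_mul] at hJ
    have e1 : ∑ a, p a * g a * ∑ l, τ l / v * s a l = T / v := by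
      rw [hTeq, Finset.sum_div]
      refine Finset.sum_congr rfl fun a _ => ?_
      rw [mul_div_assoc, Finset.sum_div]
      congr 1
      exact Finset.sum_congr rfl fun l _ => by ring
    have e2 : ∑ a, p a * g a * Real.exp (∑ l, τ l / v * s a l)
        ≤ Real.exp ε * ∑ a, p a * Real.exp (∑ l, τ l / v * s a l) := by
      rw [Finset.mul_sum]
      refine Finset.sum_le_sum fun a _ => ?_
      have := mul_le_mul_of_nonneg_left (hle a)
        (mul_nonneg (h.nonneg a) (Real.exp_pos (∑ l, τ l / v * s a l)).le)
      linarith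
    have e3 := h.mgf_le (fun l => τ l / v)
    have e4 : v * (∑ l, (τ l / v) ^ 2) / 2 = T / v / 2 := by
      simp only [div_pow, ← Finset.sum_div, ← hT]
      field_simp
    rw [e1] at hJ
    rw [e4] at e3
    have e5 : Real.exp (T / v) ≤ Real.exp (ε + T / v / 2) := by
      rw [Real.exp_add]
      exact hJ.trans (e2.trans (mul_le_mul_of_nonneg_left e3 (Real.exp_pos _).le))
    rw [Real.exp_le_exp] at e5
    have e6 : T / v ≤ 2 * ε := by linarith
    rw [div_le_iff₀ hv] at e6
    linarith
  have hsmall : ε ≤ 1 → T ≤ 8 * v * ε ^ 2 := by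
    intro hε1
    have hdev : ∀ a, (g a - 1) ^ 2 ≤ (2 * ε) ^ 2 := by
      intro a
      have h1 := Real.abs_exp_sub_one_le (x := ε) (by rwa [abs_of_pos hε])
      rw [abs_of_pos hε, abs_le] at h1
      have h2 := Real.add_one_le_exp (-ε)
      refine sq_le_sq' ?_ ?_ <;> linarith [hle a, hge a]
    have e1 : T = ∑ a, p a * ((g a - 1) * ∑ l, τ l * s a l) := by
      have e0 : ∑ a, p a * ∑ l, τ l * s a l = 0 := by
        simp only [Finset.mul_sum]
        rw [Finset.sum_comm]
        refine Finset.sum_eq_zero fun l _ => ?_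
        have := h.centered l
        rw [← mul_zero (τ l), ← this, Finset.mul_sum]
        exact Finset.sum_congr rfl fun a _ => by ring
      rw [hTeq, ← sub_zero (∑ a, p a * g a * ∑ l, τ l * s a l), ← e0, ← Finset.sum_sub_distrib]
      exact Finset.sum_congr rfl fun a _ => by ring
    -- Young's inequality, weighted so that the second-moment term is at most `T / 2` and can be
    -- absorbed.
    have e2 : T ≤ ∑ a, p a * (v * (g a - 1) ^ 2 + (∑ l, τ l * s a l) ^ 2 / (4 * v)) := by
      rw [e1]
      refine Finset.sum_le_sum fun a _ => mul_le_mul_of_nonneg_left ?_ (h.nonneg a)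
      set y := ∑ l, τ l * s a l
      have : v * (g a - 1) ^ 2 + y ^ 2 / (4 * v) - (g a - 1) * y
          = (2 * v * (g a - 1) - y) ^ 2 / (4 * v) := by
        field_simp
        ring
      have h0 : 0 ≤ (2 * v * (g a - 1) - y) ^ 2 / (4 * v) := by positivity
      linarith
    have e3 : ∑ a, p a * (v * (g a - 1) ^ 2) ≤ v * (2 * ε) ^ 2 := by
      calc _ ≤ ∑ a, p a * (v * (2 * ε) ^ 2) := Finset.sum_le_sum fun a _ =>
            mul_le_mul_of_nonneg_left (mul_le_mul_of_nonneg_left (hdev a) hv.le) (h.nonneg a)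
        _ = _ := by rw [← Finset.sum_mul, h.sum_eq_one, one_mul]
    have e4 : ∑ a, p a * ((∑ l, τ l * s a l) ^ 2 / (4 * v)) ≤ T / 2 := by
      have := h.second_moment_le hv τ
      simp only [← mul_div_assoc, ← Finset.sum_div]
      rw [div_le_iff₀ (by positivity)]
      linarith
    simp only [mul_add, Finset.sum_add_distrib] at e2
    linarith
  rcases le_total ε 1 with h1 | h1
  · rw [min_eq_left (by nlinarith)]
    exact hsmall h1
  · rw [min_eq_right (by nlinarith)]
    nlinarith [mul_pos hv hε]

end IsSubgaussianScore

end UserLDP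

/-! ### Bounded measurable functions and the information in one private release. -/

namespace UserLDP

/-- Bounded measurable real functions. -/
structure BddMeasurable {α : Type*} [MeasurableSpace α] (F : α → ℝ) : Prop where
  measurable : Measurable F
  bounded : ∃ C, ∀ x, |F x| ≤ C

namespace BddMeasurable

variable {α β : Type*} [MeasurableSpace α] [MeasurableSpace β] {F G : α → ℝ}

lemma const (c : ℝ) : BddMeasurable (fun _ : α => c) := ⟨measurable_const, |c|, fun _ => le_rfl⟩

lemma add (hF : BddMeasurable F) (hG : BddMeasurable G) : BddMeasurable fun x => F x + G x := by
  obtain ⟨C, hC⟩ := hF.bounded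
  obtain ⟨C', hC'⟩ := hG.bounded
  exact ⟨hF.measurable.add hG.measurable, C + C', fun x =>
    (abs_add_le _ _).trans (add_le_add (hC x) (hC' x))⟩

lemma mul (hF : BddMeasurable F) (hG : BddMeasurable G) : BddMeasurable fun x => F x * G x := by
  obtain ⟨C, hC⟩ := hF.bounded
  obtain ⟨C', hC'⟩ := hG.bounded
  refine ⟨hF.measurable.mul hG.measurable, C * C', fun x => ?_⟩
  rw [abs_mul]
  exact mul_le_mul (hC x) (hC' x) (abs_nonneg _) ((abs_nonneg _).trans (hC x))

lemma const_mul (hF : BddMeasurable F) (c : ℝ) : BddMeasurable fun x => c * F x :=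
  (const c).mul hF

lemma sub (hF : BddMeasurable F) (hG : BddMeasurable G) : BddMeasurable fun x => F x - G x := by
  simpa [sub_eq_add_neg] using hF.add (hG.const_mul (-1))

lemma pow_two (hF : BddMeasurable F) : BddMeasurable fun x => F x ^ 2 := by
  simpa [sq] using hF.mul hF

lemma sum {ι : Type*} (t : Finset ι) {F : ι → α → ℝ} (hF : ∀ i, BddMeasurable (F i)) :
    BddMeasurable fun x => ∑ i ∈ t, F i x := by
  classical
  induction t using Finset.induction_on with
  | empty => simpa using const (0 : ℝ)
  | insert i t hi ih => simpa [Finset.sum_insert hi] using (hF i).add ih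

lemma comp (hF : BddMeasurable F) {f : β → α} (hf : Measurable f) :
    BddMeasurable fun x => F (f x) := by
  obtain ⟨C, hC⟩ := hF.bounded
  exact ⟨hF.measurable.comp hf, C, fun x => hC _⟩

lemma integrable (hF : BddMeasurable F) (μ : Measure α) [IsFiniteMeasure μ] : Integrable F μ := by
  obtain ⟨C, hC⟩ := hF.bounded
  exact Integrable.of_bound hF.measurable.aestronglyMeasurable C (ae_of_all _ hC)

lemma integral_kernel {F : α × β → ℝ} (hF : BddMeasurable F) (κ : Kernel α β) [IsMarkovKernel κ] :
    BddMeasurable fun x => ∫ y, F (x, y) ∂κ x := by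
  obtain ⟨C, hC⟩ := hF.bounded
  refine ⟨(hF.measurable.stronglyMeasurable.integral_kernel_prod_right' (κ := κ)).measurable, C,
    fun x => ?_⟩
  have := norm_integral_le_of_norm_le_const (μ := κ x) (f := fun y => F (x, y)) (C := C)
    (ae_of_all _ fun y => hC _)
  simpa using this

end BddMeasurable

variable {α : Type*} [MeasurableSpace α]

lemma rnDeriv_toReal_le_of_le_smul {μ ν : Measure α} [IsFiniteMeasure μ] [IsFiniteMeasure ν]
    {C : ℝ} (hC : 0 ≤ C) (h : μ ≤ ENNReal.ofReal C • ν) : ∀ᵐ x ∂ν, (μ.rnDeriv ν x).toReal ≤ C := by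
  have : μ.rnDeriv ν ≤ᵐ[ν] fun _ => ENNReal.ofReal C := by
    refine ae_le_of_forall_setLIntegral_le_of_sigmaFinite (Measure.measurable_rnDeriv _ _)
      fun s _ _ => ?_
    refine (Measure.setLIntegral_rnDeriv_le s).trans ((h s).trans ?_)
    simp
  filter_upwards [this] with x hx
  exact ENNReal.toReal_le_of_le_ofReal hC hx

lemma inv_le_rnDeriv_toReal_of_le_smul {μ ν : Measure α} [IsFiniteMeasure μ] [IsFiniteMeasure ν]
    {C : ℝ} (hC : 0 < C) (hac : μ ≪ ν) (h : ν ≤ ENNReal.ofReal C • μ) :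
    ∀ᵐ x ∂ν, C⁻¹ ≤ (μ.rnDeriv ν x).toReal := by
  have : (fun _ => 1) ≤ᵐ[ν] fun x => ENNReal.ofReal C * μ.rnDeriv ν x := by
    refine ae_le_of_forall_setLIntegral_le_of_sigmaFinite measurable_const fun s hs _ => ?_
    rw [lintegral_const_mul _ (Measure.measurable_rnDeriv _ _), Measure.setLIntegral_rnDeriv hac]
    simpa using h s
  filter_upwards [this, Measure.rnDeriv_lt_top μ ν] with x hx hx'
  rw [inv_le_iff_one_le_mul₀' hC]
  have := ENNReal.toReal_mono (ENNReal.mul_ne_top ENNReal.ofReal_ne_top hx'.ne) hx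
  simpa [ENNReal.toReal_mul, ENNReal.toReal_ofReal hC.le] using this

lemma integral_sum_ofReal_smul {A : Type*} [Fintype A] {p : A → ℝ} (hp : ∀ a, 0 ≤ p a)
    (W : A → Measure α) [∀ a, IsFiniteMeasure (W a)] {F : α → ℝ} (hF : BddMeasurable F) :
    ∫ z, F z ∂(∑ a, ENNReal.ofReal (p a) • W a) = ∑ a, p a * ∫ z, F z ∂W a := by
  rw [integral_finsetSum_measure fun a _ =>
    (hF.integrable (W a)).smul_measure ENNReal.ofReal_ne_top]
  refine Finset.sum_congr rfl fun a _ => ?_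
  rw [integral_smul_measure, ENNReal.toReal_ofReal (hp a), smul_eq_mul]

lemma isProbabilityMeasure_sum_ofReal_smul {A : Type*} [Fintype A] {p : A → ℝ}
    (hp : ∀ a, 0 ≤ p a) (hp1 : ∑ a, p a = 1) (W : A → Measure α)
    [∀ a, IsProbabilityMeasure (W a)] :
    IsProbabilityMeasure (∑ a, ENNReal.ofReal (p a) • W a) := by
  constructor
  simp [Measure.finsetSum_apply, ← ENNReal.ofReal_sum_of_nonneg fun a _ => hp a, hp1]

/-- Jensen's inequality in the form of an a.e. domination. -/
lemma sq_integral_le_of_sq_le {μ : Measure α} [IsProbabilityMeasure μ] {f g : α → ℝ}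
    (hf : Integrable f μ) (hg : Integrable g μ) (h : ∀ᵐ x ∂μ, f x ^ 2 ≤ g x) :
    (∫ x, f x ∂μ) ^ 2 ≤ ∫ x, g x ∂μ := by
  set c := ∫ x, f x ∂μ with hc
  -- Tangent line of the square at the mean: `2 c f - c² ≤ f² ≤ g`.
  have h1 : ∫ x, (2 * c * f x - c ^ 2) ∂μ ≤ ∫ x, g x ∂μ := by
    refine integral_mono_ae ((hf.const_mul _).sub (integrable_const _)) hg ?_
    filter_upwards [h] with x hx
    nlinarith [sq_nonneg (f x - c)]
  rw [integral_sub (hf.const_mul _) (integrable_const _), integral_const_mul, ← hc] at h1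
  simp at h1
  linarith

/-- The information about a sub-Gaussian score carried by a single `ε`-private release. -/
lemma IsSubgaussianScore.sq_sum_integral_le {A ι : Type*} [Fintype A] [Fintype ι] {p : A → ℝ}
    {s : A → ι → ℝ} {v : ℝ} (h : IsSubgaussianScore p s v) (hv : 0 < v) {ε : ℝ} (hε : 0 < ε)
    (W : A → Measure α) [∀ a, IsProbabilityMeasure (W a)]
    (hW : ∀ a a', W a ≤ ENNReal.ofReal (Real.exp ε) • W a') {U : ι → α → ℝ}
    (hU : ∀ l, BddMeasurable (U l)) :
    (∑ a, p a * ∑ l, s a l * ∫ z, U l z ∂W a) ^ 2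
      ≤ 8 * v * min (ε ^ 2) ε * ∑ a, p a * ∫ z, ∑ l, U l z ^ 2 ∂W a := by
  -- `K` is the marginal law of the output. It is comparable to each `W a` up to `e^ε`, so `p a * g
  -- a z` below is the posterior of the data given the output `z`.
  set K : Measure α := ∑ a, ENNReal.ofReal (p a) • W a with hK
  have : IsProbabilityMeasure K :=
    isProbabilityMeasure_sum_ofReal_smul h.nonneg h.sum_eq_one W
  have hp1 : ∑ a, ENNReal.ofReal (p a) = 1 := by
    rw [← ENNReal.ofReal_sum_of_nonneg fun a _ => h.nonneg a, h.sum_eq_one, ENNReal.ofReal_one]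
  have hWK : ∀ a, W a ≤ ENNReal.ofReal (Real.exp ε) • K := by
    intro a S
    have : ∀ a', ENNReal.ofReal (p a') * W a S
        ≤ ENNReal.ofReal (p a') * (ENNReal.ofReal (Real.exp ε) * W a' S) :=
      fun a' => by gcongr; exact hW a a' S
    calc W a S = ∑ a', ENNReal.ofReal (p a') * W a S := by rw [← Finset.sum_mul, hp1, one_mul]
      _ ≤ ∑ a', ENNReal.ofReal (p a') * (ENNReal.ofReal (Real.exp ε) * W a' S) :=
        Finset.sum_le_sum fun a' _ => this a'
      _ = _ := by
        simp only [hK, Measure.smul_apply, Measure.finsetSum_apply, smul_eq_mul, Finset.mul_sum]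
        exact Finset.sum_congr rfl fun _ _ => by ring
  have hKW : ∀ a, K ≤ ENNReal.ofReal (Real.exp ε) • W a := by
    intro a S
    calc K S = ∑ a', ENNReal.ofReal (p a') * W a' S := by
          simp [hK, Measure.finsetSum_apply]
      _ ≤ ∑ a', ENNReal.ofReal (p a') * (ENNReal.ofReal (Real.exp ε) * W a S) :=
        Finset.sum_le_sum fun a' _ => by gcongr; exact hW a' a S
      _ = _ := by rw [← Finset.sum_mul, hp1, one_mul]; rfl
  have hac : ∀ a, W a ≪ K := fun a => Measure.absolutelyContinuous_of_le_smul (hWK a)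
  set g : A → α → ℝ := fun a z => ((W a).rnDeriv K z).toReal with hg
  have hgint : ∀ a, Integrable (g a) K := fun a => Measure.integrable_toReal_rnDeriv
  have hgle : ∀ᵐ z ∂K, ∀ a, g a z ≤ Real.exp ε :=
    ae_all_iff.2 fun a => rnDeriv_toReal_le_of_le_smul (Real.exp_pos _).le (hWK a)
  have hgge : ∀ᵐ z ∂K, ∀ a, Real.exp (-ε) ≤ g a z := ae_all_iff.2 fun a => by
    rw [Real.exp_neg]
    exact inv_le_rnDeriv_toReal_of_le_smul (Real.exp_pos _) (hac a) (hKW a)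
  have hgsum : ∀ᵐ z ∂K, ∑ a, p a * g a z = 1 := by
    have : (fun z => ∑ a, p a * g a z) =ᵐ[K] fun _ => (1 : ℝ) := by
      refine Integrable.ae_eq_of_forall_setIntegral_eq _ _
        (integrable_finsetSum _ fun a _ => (hgint a).const_mul _) (integrable_const _)
        fun S hS _ => ?_
      rw [integral_finsetSum _ fun a _ => ((hgint a).const_mul _).integrableOn]
      simp only [integral_const_mul, hg, Measure.setIntegral_toReal_rnDeriv (hac _)]
      have := integral_sum_ofReal_smul h.nonneg W (F := S.indicator 1)
        ⟨measurable_one.indicator hS, 1, fun x => by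
          by_cases hx : x ∈ S <;> simp [hx]⟩
      rw [← hK] at this
      simp only [integral_indicator_one hS] at this
      simp [this]
    exact this
  -- The correlation becomes the `K`-mean of `U` paired with the posterior mean of the score, to
  -- which the tilt bound applies for almost every output.
  have hτ : ∑ a, p a * ∑ l, s a l * ∫ z, U l z ∂W a
      = ∫ z, ∑ l, U l z * ∑ a, p a * g a z * s a l ∂K := by
    have hint : ∀ l a, Integrable (fun z => U l z * (p a * g a z * s a l)) K := fun l a => by
      obtain ⟨C, hC⟩ := (hU l).bounded
      exact Integrable.bdd_mul (((hgint a).const_mul _).mul_const _)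
        (hU l).measurable.aestronglyMeasurable (ae_of_all _ hC)
    simp only [Finset.mul_sum]
    rw [integral_finsetSum _ fun l _ => integrable_finsetSum _ fun a _ => hint l a,
      Finset.sum_comm]
    refine Finset.sum_congr rfl fun l _ => ?_
    rw [integral_finsetSum _ fun a _ => hint l a]
    refine Finset.sum_congr rfl fun a _ => ?_
    rw [← integral_toReal_rnDeriv_mul (hac a), ← integral_const_mul, ← integral_const_mul]
    exact integral_congr_ae (ae_of_all _ fun z => by simp only [hg]; ring)
  have hU2 : BddMeasurable fun z => ∑ l, U l z ^ 2 := BddMeasurable.sum _ fun l => (hU l).pow_two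
  rw [hτ, ← integral_sum_ofReal_smul h.nonneg W hU2, ← hK, ← integral_const_mul]
  refine sq_integral_le_of_sq_le ?_ ((hU2.const_mul _).integrable K) ?_
  · refine integrable_finsetSum _ fun l _ => ?_
    obtain ⟨C, hC⟩ := (hU l).bounded
    exact Integrable.bdd_mul (integrable_finsetSum _ fun a _ =>
      ((hgint a).const_mul _).mul_const _) (hU l).measurable.aestronglyMeasurable (ae_of_all _ hC)
  · filter_upwards [hgle, hgge, hgsum] with z h1 h2 h3
    have := h.sum_sq_tilted_mean_le hv hε h3 h1 h2
    calc _ ≤ (∑ l, U l z ^ 2) * ∑ l, (∑ a, p a * g a z * s a l) ^ 2 :=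
          Finset.sum_mul_sq_le_sq_mul_sq _ _ _
      _ ≤ (∑ l, U l z ^ 2) * (8 * v * min (ε ^ 2) ε) :=
          mul_le_mul_of_nonneg_left this (Finset.sum_nonneg fun _ _ => sq_nonneg _)
      _ = _ := mul_comm _ _

end UserLDP

/-! ### Sequential interaction: adding up the information of the users. -/

namespace UserLDP

/-- Under a finite product weight, one coordinate may be averaged out separately. -/
lemma sum_prod_mul_eq_sum_prod_mul_sum {ι A : Type*} [Fintype ι] [DecidableEq ι] [Fintype A]
    {p : A → ℝ} (hp1 : ∑ a, p a = 1) (i : ι) (G : (ι → A) → A → ℝ)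
    (hG : ∀ x a b, G (Function.update x i a) b = G x b) :
    ∑ x : ι → A, (∏ j, p (x j)) * G x (x i)
      = ∑ x : ι → A, (∏ j, p (x j)) * ∑ a, p a * G x a := by
  -- Exchanging coordinate `i` with an independent copy `a` is an involution that preserves the
  -- weight.
  have hinv : Function.Involutive
      (fun y : (ι → A) × A => (Function.update y.1 i y.2, y.1 i)) := fun y => by
    ext <;> simp
  have hprod : ∀ (x : ι → A) (a : A),
      (∏ j, p (Function.update x i a j)) * p (x i) = (∏ j, p (x j)) * p a := fun x a => by
    rw [← Finset.mul_prod_erase _ _ (Finset.mem_univ i),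
      ← Finset.mul_prod_erase _ (fun j => p (x j)) (Finset.mem_univ i)]
    have : ∏ j ∈ Finset.univ.erase i, p (Function.update x i a j)
        = ∏ j ∈ Finset.univ.erase i, p (x j) :=
      Finset.prod_congr rfl fun j hj => by
        rw [Function.update_of_ne (Finset.ne_of_mem_erase hj)]
    rw [this, Function.update_self]
    ring
  calc ∑ x : ι → A, (∏ j, p (x j)) * G x (x i)
      = ∑ x : ι → A, ∑ a, (∏ j, p (x j)) * p a * G x (x i) :=
        Finset.sum_congr rfl fun x _ => by
          rw [← Finset.sum_mul, ← Finset.mul_sum, hp1, mul_one]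
    _ = ∑ y : (ι → A) × A, (∏ j, p (y.1 j)) * p y.2 * G y.1 (y.1 i) :=
        (Fintype.sum_prod_type' fun x a => (∏ j, p (x j)) * p a * G x (x i)).symm
    _ = ∑ y : (ι → A) × A, (∏ j, p (y.1 j)) * p y.2 * G y.1 y.2 := by
        refine (Fintype.sum_equiv hinv.toPerm _ _ fun y => ?_).symm
        simp only [Function.Involutive.coe_toPerm, hprod, hG, Function.update_self]
    _ = ∑ x : ι → A, ∑ a, (∏ j, p (x j)) * p a * G x a :=
        Fintype.sum_prod_type' fun x a => (∏ j, p (x j)) * p a * G x a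
    _ = _ := Finset.sum_congr rfl fun x _ => by
        rw [Finset.mul_sum]
        exact Finset.sum_congr rfl fun a _ => by ring

lemma sum_prod_eq_one {ι A : Type*} [Fintype ι] [DecidableEq ι] [Fintype A]
    {p : A → ℝ} (hp1 : ∑ a, p a = 1) : ∑ x : ι → A, ∏ j, p (x j) = 1 := by
  rw [← Fintype.piFinset_univ, ← Finset.prod_univ_sum]
  simp [hp1]

namespace Mechanism

universe u v

variable {𝒳 : Type v} {𝒵 : Type u} [MeasurableSpace 𝒳] [MeasurableSpace 𝒵] {n m : ℕ}

lemma measurable_snoc (k : ℕ) :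
    Measurable fun q : (Fin k → 𝒵) × 𝒵 =>
      (Fin.snoc (α := fun _ => 𝒵) q.1 q.2 : Fin (k + 1) → 𝒵) := by
  refine measurable_pi_lambda _ fun i => ?_
  refine Fin.lastCases ?_ (fun j => ?_) i
  · simpa using measurable_snd
  · simp only [Fin.snoc_castSucc]
    fun_prop

instance isMarkovKernel_channel (M : Mechanism 𝒳 𝒵 n m) (i : Fin n) :
    IsMarkovKernel (M.channel i) := M.isMarkov i

instance isMarkovKernel_step (M : Mechanism 𝒳 𝒵 n m) (i : Fin n) :
    IsMarkovKernel (M.step i) := by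
  unfold step
  infer_instance

/-- The same instance with the history type written `Fin k → 𝒵`, which agrees with the original only
up to unfolding the coercion of `⟨k, hk⟩`. -/
instance isMarkovKernel_channel_mk (M : Mechanism 𝒳 𝒵 n m) (k : ℕ) (hk : k < n) :
    IsMarkovKernel (α := (Fin m → 𝒳) × (Fin k → 𝒵)) (M.channel ⟨k, hk⟩) := M.isMarkov ⟨k, hk⟩

instance isMarkovKernel_step_mk (M : Mechanism 𝒳 𝒵 n m) (k : ℕ) (hk : k < n) :
    IsMarkovKernel (α := (Fin n → Fin m → 𝒳) × (Fin k → 𝒵)) (M.step ⟨k, hk⟩) :=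
  M.isMarkovKernel_step ⟨k, hk⟩

instance isMarkovKernel_transcript (M : Mechanism 𝒳 𝒵 n m) (k : ℕ) (hk : k ≤ n) :
    IsMarkovKernel (M.transcript k hk) := by
  induction k with
  | zero => unfold transcript; infer_instance
  | succ k ih =>
    have := ih (Nat.le_of_succ_le hk)
    exact Kernel.IsMarkovKernel.map _ (measurable_snoc k)

lemma transcript_congr (M : Mechanism 𝒳 𝒵 n m) (k : ℕ) (hk : k ≤ n) {y y' : Fin n → Fin m → 𝒳}
    (h : ∀ i : Fin n, (i : ℕ) < k → y i = y' i) : M.transcript k hk y = M.transcript k hk y' := by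
  induction k with
  | zero => rfl
  | succ k ih =>
    ext S hS
    have hm := measurable_snoc (𝒵 := 𝒵) k
    simp only [transcript]
    rw [Kernel.map_apply' _ hm _ hS, Kernel.map_apply' _ hm _ hS,
      Kernel.compProd_apply (hm hS), Kernel.compProd_apply (hm hS),
      ih (Nat.le_of_succ_le hk) fun i hi => h i (hi.trans (Nat.lt_succ_self k))]
    simp only [step, Kernel.comap_apply, h ⟨k, hk⟩ (Nat.lt_succ_self k)]

lemma integral_transcript_succ (M : Mechanism 𝒳 𝒵 n m) (k : ℕ) (hk : k + 1 ≤ n)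
    (y : Fin n → Fin m → 𝒳) {F : (Fin (k + 1) → 𝒵) → ℝ} (hF : BddMeasurable F) :
    ∫ z, F z ∂(M.transcript (k + 1) hk y)
      = ∫ z, ∫ z', F (Fin.snoc (α := fun _ => 𝒵) z z') ∂(M.channel ⟨k, hk⟩ (y ⟨k, hk⟩, z))
          ∂(M.transcript k (Nat.le_of_succ_le hk) y) := by
  have hm := measurable_snoc (𝒵 := 𝒵) k
  simp only [transcript]
  rw [Kernel.map_apply _ hm, integral_map hm.aemeasurable hF.measurable.aestronglyMeasurable,
    integral_compProd ((hF.comp hm).integrable _)]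
  simp only [step, Kernel.comap_apply]

/-- The information about a sub-Gaussian score carried by the first `k` releases of a sequentially
interactive user-level private mechanism, in dual form. -/
lemma sq_sum_integral_transcript_le (M : Mechanism 𝒳 𝒵 n m) {ε : ℝ} (hε : 0 < ε)
    (hM : M.IsUserLDP ε) {A ι : Type*} [Fintype A] [Fintype ι] {p : A → ℝ} {s : A → ι → ℝ} {v : ℝ}
    (h : IsSubgaussianScore p s v) (hv : 0 < v) (e : A → Fin m → 𝒳) (k : ℕ) (hk : k ≤ n)
    {U : ι → (Fin k → 𝒵) → ℝ} (hU : ∀ l, BddMeasurable (U l)) :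
    (∑ x : Fin n → A, (∏ j, p (x j)) *
        ∑ l, (∑ i ∈ Finset.univ.filter (fun i : Fin n => (i : ℕ) < k), s (x i) l) *
          ∫ z, U l z ∂(M.transcript k hk fun i => e (x i))) ^ 2
      ≤ k * (8 * v * min (ε ^ 2) ε) * ∑ x : Fin n → A, (∏ j, p (x j)) *
          ∫ z, ∑ l, U l z ^ 2 ∂(M.transcript k hk fun i => e (x i)) := by
  induction k with
  | zero => simp
  | succ k ih =>
    have hk' := Nat.le_of_succ_le hk
    set B := 8 * v * min (ε ^ 2) ε with hB
    have hB0 : 0 ≤ B := by positivity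
    set i₀ : Fin n := ⟨k, hk⟩ with hi₀
    set T : (Fin n → A) → Measure (Fin k → 𝒵) := fun x => M.transcript k hk' fun i => e (x i) with hT
    set w : (Fin n → A) → ℝ := fun x => ∏ j, p (x j) with hw
    have hw0 : ∀ x, 0 ≤ w x := fun x => Finset.prod_nonneg fun _ _ => h.nonneg _
    have hw1 : ∑ x, w x = 1 := sum_prod_eq_one h.sum_eq_one
    set κ : A → Kernel (Fin k → 𝒵) 𝒵 := fun a =>
      Kernel.comap (α := (Fin m → 𝒳) × (Fin k → 𝒵)) (M.channel i₀) (fun z => (e a, z))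
        (by fun_prop) with hκ
    have hTprob : ∀ x, IsProbabilityMeasure (T x) := fun x => by rw [hT]; infer_instance
    have hκM : ∀ a, IsMarkovKernel (κ a) := fun a => by rw [hκ]; infer_instance
    have hm := measurable_snoc (𝒵 := 𝒵) k
    set V : ι → (Fin k → 𝒵) × 𝒵 → ℝ := fun l q => U l (Fin.snoc (α := fun _ => 𝒵) q.1 q.2) with hV
    have hVb : ∀ l, BddMeasurable (V l) := fun l => (hU l).comp hm
    have hVz : ∀ l z, BddMeasurable fun z' => V l (z, z') := fun l z =>
      (hVb l).comp measurable_prodMk_left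
    have hI : ∀ x l, ∫ z, U l z ∂(M.transcript (k + 1) hk fun i => e (x i))
        = ∫ z, ∫ z', V l (z, z') ∂(κ (x i₀) z) ∂(T x) := fun x l =>
      M.integral_transcript_succ k hk _ (hU l)
    have hI2 : ∀ x, ∫ z, ∑ l, U l z ^ 2 ∂(M.transcript (k + 1) hk fun i => e (x i))
        = ∫ z, ∫ z', ∑ l, V l (z, z') ^ 2 ∂(κ (x i₀) z) ∂(T x) := fun x =>
      M.integral_transcript_succ k hk _ (BddMeasurable.sum _ fun l => (hU l).pow_two)
    have hTu : ∀ x a, T (Function.update x i₀ a) = T x := fun x a =>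
      M.transcript_congr k hk' fun i hi => by
        rw [Function.update_of_ne (by intro h'; rw [h'] at hi; exact lt_irrefl _ hi)]
    set S : (Fin n → A) → ι → ℝ := fun x l =>
      ∑ i ∈ Finset.univ.filter (fun i : Fin n => (i : ℕ) < k), s (x i) l with hS
    have hSu : ∀ x a, S (Function.update x i₀ a) = S x := fun x a => by
      funext l
      refine Finset.sum_congr rfl fun i hi => ?_
      have hi := (Finset.mem_filter.1 hi).2
      rw [Function.update_of_ne (by intro h'; rw [h'] at hi; exact lt_irrefl _ hi)]
    have hSs : ∀ (x : Fin n → A) l,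
        ∑ i ∈ Finset.univ.filter (fun i : Fin n => (i : ℕ) < k + 1), s (x i) l = S x l + s (x i₀) l := by
      intro x l
      have : (Finset.univ.filter fun i : Fin n => (i : ℕ) < k + 1)
          = insert i₀ (Finset.univ.filter fun i : Fin n => (i : ℕ) < k) := by
        ext i
        simp [hi₀, Fin.ext_iff]
        omega
      rw [this, Finset.sum_insert (by simp [hi₀]), add_comm]
    have hcond : ∀ a {F : (Fin k → 𝒵) × 𝒵 → ℝ}, BddMeasurable F →
        BddMeasurable fun z => ∫ z', F (z, z') ∂(κ a z) := fun a F hF => hF.integral_kernel (κ a)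
    -- Conditional expectation of `U` given the first `k` releases, the data of user `i₀` being
    -- averaged out. The past score sees only `Ub`; the new score, being centered, sees only `U -
    -- Ub`.
    set Ub : ι → (Fin k → 𝒵) → ℝ := fun l z => ∑ a, p a * ∫ z', V l (z, z') ∂(κ a z) with hUb
    have hUbb : ∀ l, BddMeasurable (Ub l) := fun l =>
      BddMeasurable.sum _ fun a => (hcond a (hVb l)).const_mul _
    set φ : (Fin k → 𝒵) → ℝ :=
      fun z => ∑ a, p a * ∑ l, s a l * ∫ z', V l (z, z') ∂(κ a z) with hφ
    have hφb : BddMeasurable φ := BddMeasurable.sum _ fun a =>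
      (BddMeasurable.sum _ fun l => (hcond a (hVb l)).const_mul _).const_mul _
    set R : (Fin k → 𝒵) → ℝ :=
      fun z => ∑ a, p a * ∫ z', ∑ l, V l (z, z') ^ 2 ∂(κ a z) with hR
    have hRb : BddMeasurable R := BddMeasurable.sum _ fun a =>
      (hcond a (BddMeasurable.sum _ fun l => (hVb l).pow_two)).const_mul _
    have hUb2 : BddMeasurable fun z => ∑ l, Ub l z ^ 2 :=
      BddMeasurable.sum _ fun l => (hUbb l).pow_two
    -- The single-release bound for `V - Ub` at a fixed history; the right side is `B` times the
    -- conditional variance.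
    have hdev : ∀ z, φ z ^ 2 ≤ B * (R z - ∑ l, Ub l z ^ 2) := by
      intro z
      have hsub : ∀ l, BddMeasurable fun z' => V l (z, z') - Ub l z := fun l =>
        (hVz l z).sub (BddMeasurable.const _)
      have := h.sq_sum_integral_le hv hε (fun a => κ a z)
        (fun a a' => Measure.le_iff.2 fun S hS => hM i₀ z (e a) (e a') S hS) hsub
      have e1 : ∑ a, p a * ∑ l, s a l * ∫ z', (V l (z, z') - Ub l z) ∂(κ a z) = φ z := by
        have : ∑ a, p a * ∑ l, s a l * Ub l z = 0 := by
          simp only [Finset.mul_sum]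
          rw [Finset.sum_comm]
          refine Finset.sum_eq_zero fun l _ => ?_
          simp only [← mul_assoc, ← Finset.sum_mul, h.centered l, zero_mul]
        change _ = ∑ a, p a * ∑ l, s a l * ∫ z', V l (z, z') ∂(κ a z)
        rw [← sub_zero (∑ a, p a * ∑ l, s a l * ∫ z', V l (z, z') ∂(κ a z)), ← this,
          ← Finset.sum_sub_distrib]
        refine Finset.sum_congr rfl fun a _ => ?_
        rw [← mul_sub, ← Finset.sum_sub_distrib]
        congr 1
        refine Finset.sum_congr rfl fun l _ => ?_
        rw [integral_sub ((hVz l z).integrable _) (integrable_const _)]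
        simp [mul_sub]
      have e2 : ∑ a, p a * ∫ z', ∑ l, (V l (z, z') - Ub l z) ^ 2 ∂(κ a z)
          = R z - ∑ l, Ub l z ^ 2 := by
        have e3 : ∀ a, ∫ z', ∑ l, (V l (z, z') - Ub l z) ^ 2 ∂(κ a z)
            = ∫ z', ∑ l, V l (z, z') ^ 2 ∂(κ a z)
              - 2 * ∑ l, Ub l z * ∫ z', V l (z, z') ∂(κ a z) + ∑ l, Ub l z ^ 2 := by
          intro a
          rw [integral_finsetSum _ fun l _ => ((hsub l).pow_two).integrable _,
            integral_finsetSum _ fun l _ => ((hVz l z).pow_two).integrable _, Finset.mul_sum,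
            ← Finset.sum_sub_distrib, ← Finset.sum_add_distrib]
          refine Finset.sum_congr rfl fun l _ => ?_
          have : ∀ z', (V l (z, z') - Ub l z) ^ 2
              = V l (z, z') ^ 2 - (2 * Ub l z) * V l (z, z') + Ub l z ^ 2 := fun z' => by ring
          simp only [this]
          rw [integral_add (((hVz l z).pow_two.sub ((hVz l z).const_mul _)).integrable _)
            (integrable_const _), integral_sub ((hVz l z).pow_two.integrable _)
            (((hVz l z).const_mul _).integrable _), integral_const_mul]
          simp
          ring
        simp only [e3, mul_add, mul_sub, Finset.sum_add_distrib, Finset.sum_sub_distrib,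
          ← Finset.sum_mul, h.sum_eq_one]
        have e4 : ∑ a, p a * (2 * ∑ l, Ub l z * ∫ z', V l (z, z') ∂(κ a z))
            = 2 * ∑ l, Ub l z ^ 2 := by
          simp only [Finset.mul_sum]
          rw [Finset.sum_comm]
          refine Finset.sum_congr rfl fun l _ => ?_
          rw [sq]
          nth_rewrite 3 [hUb]
          simp only [Finset.mul_sum]
          exact Finset.sum_congr rfl fun a _ => by ring
        rw [e4, hR]
        ring
      rwa [e1, e2] at this
    -- The past score and the past releases do not depend on `x i₀`, so it may be averaged out
    -- inside.
    have hA : ∑ x, w x * ∑ l, S x l * ∫ z, ∫ z', V l (z, z') ∂(κ (x i₀) z) ∂(T x)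
        = ∑ x, w x * ∑ l, S x l * ∫ z, Ub l z ∂(T x) := by
      rw [sum_prod_mul_eq_sum_prod_mul_sum h.sum_eq_one i₀
        (fun x a => ∑ l, S x l * ∫ z, ∫ z', V l (z, z') ∂(κ a z) ∂(T x))
        (fun x a b => by simp only [hTu, hSu])]
      refine Finset.sum_congr rfl fun x _ => ?_
      congr 1
      simp only [Finset.mul_sum]
      rw [Finset.sum_comm]
      refine Finset.sum_congr rfl fun l _ => ?_
      rw [hUb, integral_finsetSum _ fun a _ => ((hcond a (hVb l)).const_mul _).integrable _,
        Finset.mul_sum]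
      refine Finset.sum_congr rfl fun a _ => ?_
      rw [integral_const_mul]
      ring
    have hC : ∑ x, w x * ∑ l, s (x i₀) l * ∫ z, ∫ z', V l (z, z') ∂(κ (x i₀) z) ∂(T x)
        = ∑ x, w x * ∫ z, φ z ∂(T x) := by
      rw [sum_prod_mul_eq_sum_prod_mul_sum h.sum_eq_one i₀
        (fun x a => ∑ l, s a l * ∫ z, ∫ z', V l (z, z') ∂(κ a z) ∂(T x))
        (fun x a b => by simp only [hTu])]
      refine Finset.sum_congr rfl fun x _ => ?_
      congr 1
      rw [hφ, integral_finsetSum _ fun a _ => ((BddMeasurable.sum _ fun l =>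
        (hcond a (hVb l)).const_mul _).const_mul _).integrable _]
      refine Finset.sum_congr rfl fun a _ => ?_
      rw [integral_const_mul, integral_finsetSum _ fun l _ =>
        ((hcond a (hVb l)).const_mul _).integrable _]
      simp only [integral_const_mul]
    have hD : ∑ x, w x * ∫ z, ∫ z', ∑ l, V l (z, z') ^ 2 ∂(κ (x i₀) z) ∂(T x)
        = ∑ x, w x * ∫ z, R z ∂(T x) := by
      rw [sum_prod_mul_eq_sum_prod_mul_sum h.sum_eq_one i₀
        (fun x a => ∫ z, ∫ z', ∑ l, V l (z, z') ^ 2 ∂(κ a z) ∂(T x))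
        (fun x a b => by simp only [hTu])]
      refine Finset.sum_congr rfl fun x _ => ?_
      congr 1
      rw [hR, integral_finsetSum _ fun a _ => ((hcond a (BddMeasurable.sum _ fun l =>
        (hVb l).pow_two)).const_mul _).integrable _]
      simp only [integral_const_mul]
    have hφsq : (∑ x, w x * ∫ z, φ z ∂(T x)) ^ 2
        ≤ B * (∑ x, w x * ∫ z, R z ∂(T x) - ∑ x, w x * ∫ z, ∑ l, Ub l z ^ 2 ∂(T x)) := by
      have := isProbabilityMeasure_sum_ofReal_smul hw0 hw1 T
      rw [← integral_sum_ofReal_smul hw0 T hφb, ← integral_sum_ofReal_smul hw0 T hRb,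
        ← integral_sum_ofReal_smul hw0 T hUb2, ← integral_sub (hRb.integrable _)
        (hUb2.integrable _), ← integral_const_mul]
      exact sq_integral_le_of_sq_le (hφb.integrable _) (((hRb.sub hUb2).const_mul B).integrable _)
        (ae_of_all _ hdev)
    have hih := ih hk' hUbb
    simp only [hI, hI2, hSs, add_mul, mul_add, Finset.sum_add_distrib]
    rw [hA, hC, hD]
    set a := ∑ x, w x * ∑ l, S x l * ∫ z, Ub l z ∂(T x)
    set b := ∑ x, w x * ∫ z, φ z ∂(T x)
    set r := ∑ x, w x * ∫ z, R z ∂(T x)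
    set α := ∑ x, w x * ∫ z, ∑ l, Ub l z ^ 2 ∂(T x)
    have hα : 0 ≤ α := Finset.sum_nonneg fun x _ => mul_nonneg (hw0 x) <|
      integral_nonneg fun z => Finset.sum_nonneg fun _ _ => sq_nonneg _
    have hkB : 0 ≤ (k : ℝ) * B := by positivity
    have hih : a ^ 2 ≤ k * B * α := hih
    have hβ : 0 ≤ B * (r - α) := (sq_nonneg b).trans hφsq
    -- AM–GM applied to `a² b² ≤ (k B α) (B (r - α))`, grouped so that adding the bounds on `a²` and
    -- `b²` gives exactly `(k + 1) B r`.
    have hcross : 2 * (a * b) ≤ k * (B * (r - α)) + B * α := by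
      refine abs_le_of_sq_le_sq' ?_ (by positivity) |>.2
      have h1 : a ^ 2 * b ^ 2 ≤ (k * B * α) * (B * (r - α)) :=
        mul_le_mul hih hφsq (sq_nonneg _) (by positivity)
      nlinarith [sq_nonneg (k * (B * (r - α)) - B * α)]
    push_cast
    nlinarith

end Mechanism

end UserLDP

/-! ### Random signs and the Bayesian Cramér–Rao identity. -/

namespace UserLDP

/-- The sign `±1` encoded by a bit. -/
def bitSign (b : Bool) : ℝ := if b then 1 else -1

/-- The probability of the bit `b` under the law on `{±1}` with mean `t`. -/
noncomputable def bitWeight (t : ℝ) (b : Bool) : ℝ := (1 + bitSign b * t) / 2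

lemma bitSign_sq (b : Bool) : bitSign b ^ 2 = 1 := by cases b <;> simp [bitSign]

lemma abs_bitSign (b : Bool) : |bitSign b| = 1 := by cases b <;> simp [bitSign]

lemma bitWeight_nonneg {t : ℝ} (ht : |t| ≤ 1) (b : Bool) : 0 ≤ bitWeight t b := by
  rw [abs_le] at ht
  cases b <;> simp [bitWeight, bitSign] <;> linarith

lemma sum_bitWeight (t : ℝ) : ∑ b, bitWeight t b = 1 := by
  simp [bitWeight, bitSign]
  ring

lemma sum_bitWeight_mul_bitSign (t : ℝ) : ∑ b, bitWeight t b * bitSign b = t := by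
  simp [bitWeight, bitSign]
  ring

lemma sum_bitWeight_mul_bitSign_sub (t : ℝ) : ∑ b, bitWeight t b * (bitSign b - t) = 0 := by
  simp [bitWeight, bitSign]
  ring

/-- The law of a random bit whose sign has mean `t`. -/
noncomputable def bitMeasure (t : ℝ) : Measure Bool :=
  ∑ b, ENNReal.ofReal (bitWeight t b) • Measure.dirac b

lemma isProbabilityMeasure_bitMeasure {t : ℝ} (ht : |t| ≤ 1) :
    IsProbabilityMeasure (bitMeasure t) :=
  isProbabilityMeasure_sum_ofReal_smul (bitWeight_nonneg ht) (sum_bitWeight t) _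

lemma integral_bitMeasure {t : ℝ} (ht : |t| ≤ 1) (f : Bool → ℝ) :
    ∫ b, f b ∂(bitMeasure t) = ∑ b, bitWeight t b * f b := by
  rw [bitMeasure, integral_sum_ofReal_smul (bitWeight_nonneg ht)]
  · simp
  · exact ⟨measurable_of_countable f, max |f true| |f false|, fun b => by cases b <;> simp⟩

lemma bitMeasure_singleton (t : ℝ) (b : Bool) :
    bitMeasure t {b} = ENNReal.ofReal (bitWeight t b) := by
  cases b <;> simp [bitMeasure]

/-- Hoeffding's lemma for a single sign. -/
lemma sum_bitWeight_mul_exp_le {t : ℝ} (ht : |t| ≤ 1) (c : ℝ) :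
    ∑ b, bitWeight t b * Real.exp (c * (bitSign b - t)) ≤ Real.exp (c ^ 2 / 2) := by
  have := isProbabilityMeasure_bitMeasure ht
  -- The range has length `2`, so the variance proxy is `(2/2)² = 1`.
  have h := (hasSubgaussianMGF_of_mem_Icc (μ := bitMeasure t) (X := bitSign) (a := -1) (b := 1)
    (measurable_of_countable _).aemeasurable (ae_of_all _ fun b => by
      cases b <;> simp [bitSign])).mgf_le c
  rw [mgf, integral_bitMeasure ht, integral_bitMeasure ht, sum_bitWeight_mul_bitSign] at h
  convert h using 2
  norm_num

/-- The probability of a local data set of `m` sign vectors with mean `θ`. -/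
noncomputable def sampleWeight {m d : ℕ} (θ : Fin d → ℝ) (a : Fin m → Fin d → Bool) : ℝ :=
  ∏ j, ∏ l, bitWeight (θ l) (a j l)

/-- The centered sum of the samples of a local data set. -/
noncomputable def sampleScore {m d : ℕ} (θ : Fin d → ℝ) (a : Fin m → Fin d → Bool) (l : Fin d) :
    ℝ :=
  ∑ j, (bitSign (a j l) - θ l)

lemma sum_prod_prod_apply {m d : ℕ} (f : Fin m → Fin d → Bool → ℝ) :
    ∑ a : Fin m → Fin d → Bool, ∏ j, ∏ l, f j l (a j l) = ∏ j, ∏ l, ∑ b, f j l b := by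
  simp only [Finset.prod_univ_sum, Fintype.piFinset_univ]

lemma sum_sampleWeight {m d : ℕ} (θ : Fin d → ℝ) :
    ∑ a : Fin m → Fin d → Bool, sampleWeight θ a = 1 := by
  simp only [sampleWeight]
  rw [sum_prod_prod_apply (fun _ l b => bitWeight (θ l) b)]
  simp only [sum_bitWeight, Finset.prod_const_one]

lemma isSubgaussianScore_sampleScore {m d : ℕ} {θ : Fin d → ℝ} (hθ : ∀ l, |θ l| ≤ 1) :
    IsSubgaussianScore (sampleWeight (m := m) θ) (sampleScore θ) m where
  nonneg a := Finset.prod_nonneg fun _ _ => Finset.prod_nonneg fun _ _ => bitWeight_nonneg (hθ _) _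
  sum_eq_one := sum_sampleWeight θ
  centered l := by
    simp only [sampleScore, Finset.mul_sum]
    rw [Finset.sum_comm]
    refine Finset.sum_eq_zero fun j _ => ?_
    have : ∀ a : Fin m → Fin d → Bool, sampleWeight θ a * (bitSign (a j l) - θ l)
        = ∏ j', ∏ l', bitWeight (θ l') (a j' l')
          * (if j' = j then if l' = l then bitSign (a j' l') - θ l' else 1 else 1) := by
      intro a
      simp only [Finset.prod_mul_distrib, sampleWeight]
      congr 1
      rw [Finset.prod_eq_single j (fun j' _ h => by simp [h]) (by simp),
        Finset.prod_eq_single l (fun l' _ h => by simp [h]) (by simp)]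
      simp
    simp only [this]
    rw [sum_prod_prod_apply (fun j' l' b => bitWeight (θ l') b
      * (if j' = j then if l' = l then bitSign b - θ l' else 1 else 1))]
    refine Finset.prod_eq_zero (Finset.mem_univ j) (Finset.prod_eq_zero (Finset.mem_univ l) ?_)
    simpa using sum_bitWeight_mul_bitSign_sub (θ l)
  mgf_le c := by
    have : ∀ a : Fin m → Fin d → Bool, sampleWeight θ a * Real.exp (∑ l, c l * sampleScore θ a l)
        = ∏ j, ∏ l, bitWeight (θ l) (a j l) * Real.exp (c l * (bitSign (a j l) - θ l)) := by
      intro a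
      simp only [Finset.prod_mul_distrib, sampleWeight, ← Real.exp_sum, sampleScore,
        Finset.mul_sum]
      rw [Finset.sum_comm]
    simp only [this]
    rw [sum_prod_prod_apply (fun _ l b => bitWeight (θ l) b * Real.exp (c l * (bitSign b - θ l)))]
    calc _ ≤ ∏ _j : Fin m, ∏ l, Real.exp (c l ^ 2 / 2) :=
          Finset.prod_le_prod (fun _ _ => Finset.prod_nonneg fun l _ => Finset.sum_nonneg fun b _ =>
            mul_nonneg (bitWeight_nonneg (hθ l) b) (Real.exp_pos _).le) fun _ _ =>
            Finset.prod_le_prod (fun l _ => Finset.sum_nonneg fun b _ =>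
              mul_nonneg (bitWeight_nonneg (hθ l) b) (Real.exp_pos _).le) fun l _ =>
              sum_bitWeight_mul_exp_le (hθ l) (c l)
      _ = _ := by
          rw [← Real.exp_sum, Finset.prod_const, ← Real.exp_nat_mul, ← Finset.sum_div]
          simp [mul_div_assoc]

/-- The score identity behind the integration by parts against the uniform prior on `[-1, 1]`. -/
lemma hasDerivAt_sub_mul_prod_bitWeight {β : Type*} [Fintype β] (y : β → Bool) (c t : ℝ) :
    HasDerivAt (fun t => (c - t) * (1 - t ^ 2) * ∏ r, bitWeight t (y r))
      ((∏ r, bitWeight t (y r)) * ((c - t) * (∑ r, (bitSign (y r) - t) - 2 * t))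
        - (∏ r, bitWeight t (y r)) * (1 - t ^ 2)) t := by
  classical
  have h1 : ∀ r ∈ Finset.univ, HasDerivAt (fun t => bitWeight t (y r)) (bitSign (y r) / 2) t :=
    fun r _ => by
      have := (((hasDerivAt_id t).const_mul (bitSign (y r))).const_add 1).div_const 2
      simpa [bitWeight] using this
  have h2 := HasDerivAt.fun_finsetProd h1
  have h3 := (((hasDerivAt_id t).const_sub c).mul (((hasDerivAt_id t).pow 2).const_sub 1)).mul h2
  refine h3.congr_deriv ?_
  have h4 : (1 - t ^ 2) * ∑ r, (∏ r' ∈ Finset.univ.erase r, bitWeight t (y r')) • (bitSign (y r) / 2)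
      = (∏ r, bitWeight t (y r)) * ∑ r, (bitSign (y r) - t) := by
    rw [Finset.mul_sum, Finset.mul_sum]
    refine Finset.sum_congr rfl fun r _ => ?_
    rw [← Finset.mul_prod_erase _ _ (Finset.mem_univ r), smul_eq_mul]
    -- The weight `1 - t²` turns the logarithmic derivative of `bitWeight` into the centered sign,
    -- so no singularity at `±1` appears.
    have : bitWeight t (y r) * (bitSign (y r) - t) = (1 - t ^ 2) * (bitSign (y r) / 2) := by
      have := bitSign_sq (y r)
      rw [bitWeight]
      linear_combination (t / 2) * this
    linear_combination -(∏ r' ∈ Finset.univ.erase r, bitWeight t (y r')) * this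
  simp only [Pi.mul_apply, Pi.pow_apply, id, Nat.cast_ofNat]
  linear_combination (c - t) * h4

/-- The uniform distribution on `[-1, 1]`. -/
noncomputable def unifPrior : Measure ℝ := (2⁻¹ : ℝ≥0∞) • volume.restrict (Set.Icc (-1) 1)

instance isProbabilityMeasure_unifPrior : IsProbabilityMeasure unifPrior := by
  constructor
  simp only [unifPrior, Measure.smul_apply, Measure.restrict_apply_univ, Real.volume_Icc]
  norm_num
  exact ENNReal.inv_mul_cancel (by simp) (by simp)

lemma integral_unifPrior (f : ℝ → ℝ) :
    ∫ t, f t ∂unifPrior = 2⁻¹ * ∫ t in (-1)..1, f t := by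
  rw [unifPrior, integral_smul_measure, intervalIntegral.integral_of_le (by norm_num),
    integral_Icc_eq_integral_Ioc]
  simp

lemma ae_unifPrior_abs_le : ∀ᵐ t ∂unifPrior, |t| ≤ 1 := by
  refine Measure.ae_smul_measure ?_ _
  filter_upwards [ae_restrict_mem measurableSet_Icc] with t ht using abs_le.2 ht

lemma continuous_bitWeight (b : Bool) : Continuous fun t => bitWeight t b := by
  unfold bitWeight
  fun_prop

/-- The two sides differ by the integral of a derivative whose primitive vanishes at `±1` thanks to
the factor `1 - t²`. -/
lemma integral_unifPrior_score {β : Type*} [Fintype β] (y : β → Bool) (c : ℝ) :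
    ∫ t, (∏ r, bitWeight t (y r)) * ((c - t) * (∑ r, (bitSign (y r) - t) - 2 * t)) ∂unifPrior
      = ∫ t, (∏ r, bitWeight t (y r)) * (1 - t ^ 2) ∂unifPrior := by
  have hc : Continuous fun t => ∏ r, bitWeight t (y r) :=
    continuous_finsetProd _ fun r _ => continuous_bitWeight _
  rw [integral_unifPrior, integral_unifPrior]
  congr 1
  rw [← sub_eq_zero, ← intervalIntegral.integral_sub
    (Continuous.intervalIntegrable (by fun_prop) _ _)
    (Continuous.intervalIntegrable (by fun_prop) _ _),
    intervalIntegral.integral_eq_sub_of_hasDerivAt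
      (fun t _ => hasDerivAt_sub_mul_prod_bitWeight y c t)
      (Continuous.intervalIntegrable (by fun_prop) _ _)]
  norm_num

lemma integral_unifPrior_one_sub_sq : ∫ t, (1 - t ^ 2) ∂unifPrior = 2 / 3 := by
  rw [integral_unifPrior, intervalIntegral.integral_sub (by simp)
    (Continuous.intervalIntegrable (by fun_prop) _ _), integral_pow]
  norm_num

/-- The uniform distribution on the cube `[-1, 1]^d`. -/
noncomputable def cubePrior (d : ℕ) : Measure (Fin d → ℝ) := Measure.pi fun _ => unifPrior

instance isProbabilityMeasure_cubePrior (d : ℕ) : IsProbabilityMeasure (cubePrior d) := by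
  unfold cubePrior
  infer_instance

lemma ae_cubePrior_abs_le (d : ℕ) : ∀ᵐ θ ∂(cubePrior d), ∀ l, |θ l| ≤ 1 :=
  ae_all_iff.2 fun l => (Measure.tendsto_eval_ae_ae (μ := fun _ : Fin d => unifPrior) (i := l))
    ae_unifPrior_abs_le

lemma integrable_cubePrior {d : ℕ} {f : (Fin d → ℝ) → ℝ} (hf : Continuous f) :
    Integrable f (cubePrior d) := by
  obtain ⟨C, hC⟩ := (isCompact_closedBall (0 : Fin d → ℝ) 1).exists_bound_of_continuousOn
    hf.continuousOn
  refine Integrable.of_bound hf.aestronglyMeasurable C ?_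
  filter_upwards [ae_cubePrior_abs_le d] with θ hθ
  refine hC θ ?_
  rw [mem_closedBall_zero_iff, pi_norm_le_iff_of_nonneg zero_le_one]
  exact hθ

lemma integral_cubePrior_prod_mul {d : ℕ} (F : Fin d → ℝ → ℝ) (q : ℝ → ℝ) (l : Fin d) :
    ∫ θ, (∏ l', F l' (θ l')) * q (θ l) ∂(cubePrior d)
      = (∫ t, F l t * q t ∂unifPrior) * ∏ l' ∈ Finset.univ.erase l, ∫ t, F l' t ∂unifPrior := by
  have h := integral_fintype_prod_eq_prod (𝕜 := ℝ) (μ := fun _ : Fin d => unifPrior)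
    (fun l' t => F l' t * if l' = l then q t else 1)
  rw [← Finset.mul_prod_erase _ _ (Finset.mem_univ l)] at h
  simp only [Finset.prod_mul_distrib, Finset.prod_ite_eq', Finset.mem_univ, if_true] at h
  rw [cubePrior, h]
  congr 1
  refine Finset.prod_congr rfl fun l' hl' => ?_
  simp [Finset.ne_of_mem_erase hl']

lemma prod_sampleWeight_eq {n m d : ℕ} (θ : Fin d → ℝ) (x : Fin n → Fin m → Fin d → Bool) :
    ∏ i, sampleWeight θ (x i) = ∏ l, ∏ r : Fin n × Fin m, bitWeight (θ l) (x r.1 r.2 l) := by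
  simp only [sampleWeight, Fintype.prod_prod_type]
  rw [Finset.prod_congr rfl fun i _ => Finset.prod_comm, Finset.prod_comm]

/-- For every family `t` of conditional estimates some parameter in the cube is correlated with the
score by at least `2 d / 3`: the Bayesian Cramér–Rao identity for the uniform prior. -/
lemma exists_two_mul_div_three_le_sum_score {n m d : ℕ}
    (t : (Fin n → Fin m → Fin d → Bool) → Fin d → ℝ) :
    ∃ θ : Fin d → ℝ, (∀ l, |θ l| ≤ 1) ∧
      2 * (d : ℝ) / 3 ≤ ∑ x : Fin n → Fin m → Fin d → Bool, (∏ i, sampleWeight θ (x i)) *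
        ∑ l, (t x l - θ l) * (∑ i, sampleScore θ (x i) l - 2 * θ l) := by
  have hcw : ∀ x : Fin n → Fin m → Fin d → Bool,
      Continuous fun θ : Fin d → ℝ => ∏ i, sampleWeight θ (x i) := fun x => by
    simp only [sampleWeight]
    refine continuous_finsetProd _ fun i _ => continuous_finsetProd _ fun j _ =>
      continuous_finsetProd _ fun l _ => (continuous_bitWeight _).comp (continuous_apply l)
  have hcs : ∀ (x : Fin n → Fin m → Fin d → Bool) l,
      Continuous fun θ : Fin d → ℝ => ∑ i, sampleScore θ (x i) l := fun x l => by
    simp only [sampleScore]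
    fun_prop
  have hc1 : ∀ x l, Continuous fun θ : Fin d → ℝ => (∏ i, sampleWeight θ (x i)) *
      ((t x l - θ l) * (∑ i, sampleScore θ (x i) l - 2 * θ l)) := fun x l =>
    (hcw x).mul (Continuous.mul (by fun_prop) ((hcs x l).sub (by fun_prop)))
  have hc2 : ∀ (x : Fin n → Fin m → Fin d → Bool) l,
      Continuous fun θ : Fin d → ℝ => (∏ i, sampleWeight θ (x i)) * (1 - θ l ^ 2) := fun x l =>
    (hcw x).mul (by fun_prop)
  have hswap : ∀ x l, ∫ θ, (∏ i, sampleWeight θ (x i)) *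
      ((t x l - θ l) * (∑ i, sampleScore θ (x i) l - 2 * θ l)) ∂(cubePrior d)
      = ∫ θ, (∏ i, sampleWeight θ (x i)) * (1 - θ l ^ 2) ∂(cubePrior d) := by
    intro x l
    have h1 := integral_cubePrior_prod_mul
      (fun l' u => ∏ r : Fin n × Fin m, bitWeight u (x r.1 r.2 l'))
      (fun u => (t x l - u) * (∑ r : Fin n × Fin m, (bitSign (x r.1 r.2 l) - u) - 2 * u)) l
    have h2 := integral_cubePrior_prod_mul
      (fun l' u => ∏ r : Fin n × Fin m, bitWeight u (x r.1 r.2 l')) (fun u => 1 - u ^ 2) l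
    rw [integral_unifPrior_score, ← h2] at h1
    simpa only [prod_sampleWeight_eq, sampleScore, Fintype.sum_prod_type] using h1
  have hint : ∫ θ, ∑ x : Fin n → Fin m → Fin d → Bool, (∏ i, sampleWeight θ (x i)) *
        ∑ l, (t x l - θ l) * (∑ i, sampleScore θ (x i) l - 2 * θ l) ∂(cubePrior d)
      = 2 * (d : ℝ) / 3 := by
    simp only [Finset.mul_sum]
    rw [integral_finsetSum _ fun x _ => integrable_finsetSum _ fun l _ =>
      integrable_cubePrior (hc1 x l)]
    have : ∀ x, ∫ θ, ∑ l, (∏ i, sampleWeight θ (x i)) *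
        ((t x l - θ l) * (∑ i, sampleScore θ (x i) l - 2 * θ l)) ∂(cubePrior d)
        = ∑ l, ∫ θ, (∏ i, sampleWeight θ (x i)) * (1 - θ l ^ 2) ∂(cubePrior d) := fun x => by
      rw [integral_finsetSum _ fun l _ => integrable_cubePrior (hc1 x l)]
      exact Finset.sum_congr rfl fun l _ => hswap x l
    simp only [this]
    rw [Finset.sum_comm]
    have : ∀ l : Fin d, ∑ x : Fin n → Fin m → Fin d → Bool,
        ∫ θ, (∏ i, sampleWeight θ (x i)) * (1 - θ l ^ 2) ∂(cubePrior d) = 2 / 3 := fun l => by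
      rw [← integral_finsetSum _ fun x _ => integrable_cubePrior (hc2 x l)]
      simp only [← Finset.sum_mul, sum_prod_eq_one (sum_sampleWeight _)]
      have := integral_cubePrior_prod_mul (fun _ _ => 1) (fun u => 1 - u ^ 2) l
      simpa [integral_unifPrior_one_sub_sq] using this
    simp only [this]
    simp
    ring
  -- Some point outside the null set where `θ` leaves the cube reaches at least the prior average.
  obtain ⟨θ, hθ, hle⟩ := exists_notMem_null_integral_le (μ := cubePrior d)
    (N := {θ | ¬ ∀ l, |θ l| ≤ 1})
    (f := fun θ => ∑ x : Fin n → Fin m → Fin d → Bool, (∏ i, sampleWeight θ (x i)) *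
        ∑ l, (t x l - θ l) * (∑ i, sampleScore θ (x i) l - 2 * θ l))
    (by
      simp only [Finset.mul_sum]
      exact integrable_finsetSum _ fun x _ => integrable_finsetSum _ fun l _ =>
        integrable_cubePrior (hc1 x l))
    (ae_iff.1 (ae_cubePrior_abs_le d))
  refine ⟨θ, by simpa using hθ, ?_⟩
  rw [hint] at hle
  exact hle

end UserLDP

/-! ### The hard family on the vertices of the ball, and the minimax bound. -/

namespace UserLDP

/-- The vertex of the `ℓ∞` ball with prescribed signs. -/
noncomputable def signPoint {d : ℕ} {D : ℝ} (hD : 0 < D) (b : Fin d → Bool) : linftyBall d D :=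
  ⟨WithLp.toLp 2 fun l => D * bitSign (b l), fun l => by
    simp [abs_mul, abs_bitSign, abs_of_pos hD]⟩

/-- The product distribution with mean `D θ` on the vertices of the `ℓ∞` ball. -/
noncomputable def signLaw {d : ℕ} {D : ℝ} (hD : 0 < D) (θ : Fin d → ℝ) :
    Measure (linftyBall d D) :=
  (Measure.pi fun l => bitMeasure (θ l)).map (signPoint hD)

section signLaw

variable {d : ℕ} {D : ℝ} (hD : 0 < D) {θ : Fin d → ℝ}

lemma isProbabilityMeasure_signLaw (hθ : ∀ l, |θ l| ≤ 1) :
    IsProbabilityMeasure (signLaw hD θ) := by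
  have := fun l => isProbabilityMeasure_bitMeasure (hθ l)
  exact Measure.isProbabilityMeasure_map (measurable_of_countable _).aemeasurable

lemma mean_signLaw_apply (hθ : ∀ l, |θ l| ≤ 1) (l : Fin d) :
    mean (signLaw hD θ) l = D * θ l := by
  have := fun l => isProbabilityMeasure_bitMeasure (hθ l)
  rw [mean, signLaw, integral_map (measurable_of_countable _).aemeasurable
    continuous_subtype_val.aestronglyMeasurable,
    eval_integral_piLp fun l => Integrable.of_finite]
  simp only [signPoint]
  rw [integral_const_mul, integral_comp_eval (μ := fun l => bitMeasure (θ l))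
    (measurable_of_countable bitSign).aestronglyMeasurable, integral_bitMeasure (hθ l),
    sum_bitWeight_mul_bitSign]

variable {𝒵 : Type*} [MeasurableSpace 𝒵] {n m : ℕ}

lemma lintegral_law_signLaw (hθ : ∀ l, |θ l| ≤ 1) (M : Mechanism (linftyBall d D) 𝒵 n m)
    {F : (Fin n → 𝒵) → ℝ≥0∞} (hF : Measurable F) :
    ∫⁻ z, F z ∂(M.law (signLaw hD θ))
      = ∑ x : Fin n → Fin m → Fin d → Bool, ENNReal.ofReal (∏ i, sampleWeight θ (x i)) *
          ∫⁻ z, F z ∂(M.transcript n le_rfl fun i j => signPoint hD (x i j)) := by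
  have := fun l => isProbabilityMeasure_bitMeasure (hθ l)
  have := isProbabilityMeasure_signLaw hD hθ
  have hsp : Measurable (signPoint (d := d) hD) := measurable_of_countable _
  have h1 : (Measure.pi fun _ : Fin m => signLaw hD θ)
      = (Measure.pi fun _ : Fin m => Measure.pi fun l => bitMeasure (θ l)).map
          fun a j => signPoint hD (a j) := by
    have hs : ∀ _ : Fin m, SigmaFinite
        ((Measure.pi fun l => bitMeasure (θ l)).map (signPoint (D := D) hD)) := fun _ => by
      rw [signLaw] at this
      infer_instance
    rw [Measure.pi_map_pi (μ := fun _ => Measure.pi fun l => bitMeasure (θ l)) (hμ := hs)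
      (f := fun _ => signPoint hD) fun _ => hsp.aemeasurable]
    rfl
  have hsp1 : Measurable fun (a : Fin m → Fin d → Bool) j => signPoint hD (a j) :=
    measurable_of_countable _
  have h2 : (Measure.pi fun _ : Fin n => Measure.pi fun _ : Fin m => signLaw hD θ)
      = (Measure.pi fun _ : Fin n => Measure.pi fun _ : Fin m =>
          Measure.pi fun l => bitMeasure (θ l)).map fun x i j => signPoint hD (x i j) := by
    have hp : IsProbabilityMeasure (Measure.pi fun _ : Fin m => signLaw hD θ) := inferInstance
    rw [h1] at hp ⊢
    rw [Measure.pi_map_pi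
      (μ := fun _ => Measure.pi fun _ : Fin m => Measure.pi fun l => bitMeasure (θ l))
      (hμ := fun _ => inferInstance)
      (f := fun _ (a : Fin m → Fin d → Bool) j => signPoint hD (a j)) fun _ => hsp1.aemeasurable]
  rw [Mechanism.law, Measure.lintegral_bind (M.transcript n le_rfl).measurable.aemeasurable
    hF.aemeasurable, h2, lintegral_map hF.lintegral_kernel (measurable_of_countable _),
    lintegral_fintype]
  refine Finset.sum_congr rfl fun x _ => ?_
  rw [mul_comm]
  congr 1
  simp only [Measure.pi_singleton, bitMeasure_singleton, sampleWeight]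
  rw [ENNReal.ofReal_prod_of_nonneg fun i _ => Finset.prod_nonneg fun j _ =>
    Finset.prod_nonneg fun l _ => bitWeight_nonneg (hθ l) _]
  refine Finset.prod_congr rfl fun i _ => ?_
  rw [ENNReal.ofReal_prod_of_nonneg fun j _ => Finset.prod_nonneg fun l _ =>
    bitWeight_nonneg (hθ l) _]
  refine Finset.prod_congr rfl fun j _ => ?_
  rw [ENNReal.ofReal_prod_of_nonneg fun l _ => bitWeight_nonneg (hθ l) _]

end signLaw

/-- Projection of the real line onto `[-1, 1]`. -/
noncomputable def clip (y : ℝ) : ℝ := max (-1) (min 1 y)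

lemma abs_clip_le (y : ℝ) : |clip y| ≤ 1 := by
  rw [abs_le, clip]
  exact ⟨le_max_left _ _, max_le (by norm_num) (min_le_left _ _)⟩

lemma sq_clip_sub_le {t : ℝ} (ht : |t| ≤ 1) (y : ℝ) : (clip y - t) ^ 2 ≤ (y - t) ^ 2 := by
  rw [abs_le] at ht
  unfold clip
  rcases le_total y 1 with h | h
  · rw [min_eq_right h]
    rcases le_total (-1) y with h' | h'
    · rw [max_eq_right h']
    · rw [max_eq_left h']
      nlinarith
  · rw [min_eq_left h, max_eq_right (by norm_num)]
    nlinarith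

variable {𝒵 : Type*} [MeasurableSpace 𝒵] {𝒳 : Type*} [MeasurableSpace 𝒳] {d n m : ℕ}

/-- For every private mechanism and every estimator with values in `[-1, 1]^d` there is a parameter
at which the mean squared error is large. -/
lemma Mechanism.exists_sq_le_mul_risk (M : Mechanism 𝒳 𝒵 n m) {ε : ℝ} (hε : 0 < ε)
    (hm : 1 ≤ m) (hM : M.IsUserLDP ε) (e : (Fin m → Fin d → Bool) → Fin m → 𝒳)
    {C : Fin d → (Fin n → 𝒵) → ℝ} (hC : ∀ l, BddMeasurable (C l)) :
    ∃ θ : Fin d → ℝ, (∀ l, |θ l| ≤ 1) ∧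
      (2 * (d : ℝ) / 3) ^ 2 ≤ (16 * (n * m * min (ε ^ 2) ε) + 8 * d) *
        ∑ x : Fin n → Fin m → Fin d → Bool, (∏ i, sampleWeight θ (x i)) *
          ∫ z, ∑ l, (C l z - θ l) ^ 2 ∂(M.transcript n le_rfl fun i => e (x i)) := by
  -- The conditional mean of the estimator given the data does not depend on `θ`, as integration by
  -- parts in `θ` requires.
  obtain ⟨θ, hθ, hle⟩ := exists_two_mul_div_three_le_sum_score (n := n) (m := m)
    fun x l => ∫ z, C l z ∂(M.transcript n le_rfl fun i => e (x i))
  refine ⟨θ, hθ, ?_⟩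
  set T : (Fin n → Fin m → Fin d → Bool) → Measure (Fin n → 𝒵) :=
    fun x => M.transcript n le_rfl fun i => e (x i) with hT
  have hTprob : ∀ x, IsProbabilityMeasure (T x) := fun x => by rw [hT]; infer_instance
  set w : (Fin n → Fin m → Fin d → Bool) → ℝ := fun x => ∏ i, sampleWeight θ (x i) with hw
  have hscore := isSubgaussianScore_sampleScore (m := m) hθ
  have hw0 : ∀ x, 0 ≤ w x := fun x => Finset.prod_nonneg fun _ _ => hscore.nonneg _
  have hw1 : ∑ x, w x = 1 := sum_prod_eq_one hscore.sum_eq_one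
  have hU : ∀ l, BddMeasurable fun z => C l z - θ l := fun l => (hC l).sub (BddMeasurable.const _)
  have h1 := M.sq_sum_integral_transcript_le hε hM hscore (by exact_mod_cast hm) e n le_rfl hU
  simp only [Fin.is_lt, Finset.filter_true] at h1
  have hUT : ∀ x l, ∫ z, (C l z - θ l) ∂(T x) = ∫ z, C l z ∂(T x) - θ l := fun x l => by
    rw [integral_sub ((hC l).integrable _) (integrable_const _)]
    simp
  have hlin : BddMeasurable fun z => ∑ l, θ l * (C l z - θ l) :=
    BddMeasurable.sum _ fun l => (hU l).const_mul _
  have hsq : BddMeasurable fun z => ∑ l, (C l z - θ l) ^ 2 :=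
    BddMeasurable.sum _ fun l => (hU l).pow_two
  have h2 : (∑ x, w x * ∫ z, ∑ l, θ l * (C l z - θ l) ∂(T x)) ^ 2
      ≤ d * ∑ x, w x * ∫ z, ∑ l, (C l z - θ l) ^ 2 ∂(T x) := by
    have := isProbabilityMeasure_sum_ofReal_smul hw0 hw1 T
    rw [← integral_sum_ofReal_smul hw0 T hlin, ← integral_sum_ofReal_smul hw0 T hsq,
      ← integral_const_mul]
    refine sq_integral_le_of_sq_le (hlin.integrable _) ((hsq.const_mul _).integrable _)
      (ae_of_all _ fun z => ?_)
    refine (Finset.sum_mul_sq_le_sq_mul_sq _ _ _).trans ?_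
    refine mul_le_mul_of_nonneg_right ?_ (Finset.sum_nonneg fun _ _ => sq_nonneg _)
    calc ∑ l, θ l ^ 2 ≤ ∑ _l : Fin d, (1 : ℝ) :=
          Finset.sum_le_sum fun l _ => (sq_le_one_iff_abs_le_one _).2 (hθ l)
      _ = d := by simp
  set R := ∑ x, w x * ∫ z, ∑ l, (C l z - θ l) ^ 2 ∂(T x) with hR
  set a := ∑ x, w x * ∑ l, (∑ i, sampleScore θ (x i) l) * ∫ z, (C l z - θ l) ∂(T x) with ha
  set b := ∑ x, w x * ∫ z, ∑ l, θ l * (C l z - θ l) ∂(T x) with hb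
  have hsplit : ∑ x, w x * ∑ l, (∫ z, C l z ∂(T x) - θ l)
      * (∑ i, sampleScore θ (x i) l - 2 * θ l) = a - 2 * b := by
    rw [ha, hb, Finset.mul_sum, ← Finset.sum_sub_distrib]
    refine Finset.sum_congr rfl fun x _ => ?_
    rw [integral_finsetSum _ fun l _ => ((hU l).const_mul _).integrable _]
    simp only [integral_const_mul, hUT]
    rw [mul_left_comm, ← mul_sub]
    congr 1
    rw [Finset.mul_sum, ← Finset.sum_sub_distrib]
    exact Finset.sum_congr rfl fun l _ => by ring
  have hle : 2 * (d : ℝ) / 3 ≤ a - 2 * b := hle.trans_eq hsplit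
  have h1 : a ^ 2 ≤ n * (8 * m * min (ε ^ 2) ε) * R := h1
  have h3 : (2 * (d : ℝ) / 3) ^ 2 ≤ (a - 2 * b) ^ 2 := pow_le_pow_left₀ (by positivity) hle 2
  -- Uses `(a - 2b)² ≤ 2a² + 8b²`.
  nlinarith [sq_nonneg (a + 2 * b)]

/-- The factor is at most `24 max(K, d)`, and `24 · 9/4 = 54`. -/
lemma min_div_le_of_sq_le {d K R : ℝ} (hd : 0 < d) (hK : 0 < K) (hR : 0 ≤ R)
    (h : (2 * d / 3) ^ 2 ≤ (16 * K + 8 * d) * R) : min (d ^ 2 / K) d ≤ 54 * R := by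
  rcases le_total d K with hdK | hdK
  · refine (min_le_left _ _).trans ?_
    rw [div_le_iff₀ hK]
    nlinarith [mul_le_mul_of_nonneg_right hdK hR]
  · refine (min_le_right _ _).trans ?_
    have h1 : d * d ≤ d * (54 * R) := by nlinarith [mul_le_mul_of_nonneg_right hdK hR]
    exact le_of_mul_le_mul_left h1 hd

/-- Clipping the rescaled estimate to the cube cannot increase the error, and it makes an arbitrary
estimator bounded, so the Bochner-integral argument covers estimators of infinite risk too. -/
lemma ofReal_le_mse_signLaw {D : ℝ} (hD : 0 < D) {θ : Fin d → ℝ} (hθ : ∀ l, |θ l| ≤ 1)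
    (M : Mechanism (linftyBall d D) 𝒵 n m) {est : (Fin n → 𝒵) → EuclideanSpace ℝ (Fin d)}
    (hest : Measurable est) (hC : ∀ l, BddMeasurable fun z => clip (est z l / D)) :
    ENNReal.ofReal (D ^ 2 * ∑ x : Fin n → Fin m → Fin d → Bool, (∏ i, sampleWeight θ (x i)) *
      ∫ z, ∑ l, (clip (est z l / D) - θ l) ^ 2
        ∂(M.transcript n le_rfl fun i j => signPoint hD (x i j)))
      ≤ mse est M (signLaw hD θ) := by
  have hsq : BddMeasurable fun z => D ^ 2 * ∑ l, (clip (est z l / D) - θ l) ^ 2 :=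
    (BddMeasurable.sum _ fun l => ((hC l).sub (BddMeasurable.const _)).pow_two).const_mul _
  have hpt : ∀ z, D ^ 2 * ∑ l, (clip (est z l / D) - θ l) ^ 2
      ≤ ‖est z - mean (signLaw hD θ)‖ ^ 2 := fun z => by
    rw [EuclideanSpace.norm_sq_eq, Finset.mul_sum]
    refine Finset.sum_le_sum fun l _ => ?_
    have : est z l - D * θ l = D * (est z l / D - θ l) := by field_simp
    rw [PiLp.sub_apply, mean_signLaw_apply hD hθ, Real.norm_eq_abs, sq_abs, this, mul_pow]
    exact mul_le_mul_of_nonneg_left (sq_clip_sub_le (hθ l) _) (sq_nonneg _)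
  have hw0 : ∀ x : Fin n → Fin m → Fin d → Bool, 0 ≤ ∏ i, sampleWeight θ (x i) := fun x =>
    Finset.prod_nonneg fun _ _ => (isSubgaussianScore_sampleScore hθ).nonneg _
  have h0 : ∀ z, 0 ≤ D ^ 2 * ∑ l, (clip (est z l / D) - θ l) ^ 2 := fun z => by positivity
  rw [mse, lintegral_law_signLaw hD hθ M (by fun_prop), Finset.mul_sum,
    ENNReal.ofReal_sum_of_nonneg fun x _ => mul_nonneg (sq_nonneg _) (mul_nonneg (hw0 x)
      (integral_nonneg fun z => Finset.sum_nonneg fun _ _ => sq_nonneg _))]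
  refine Finset.sum_le_sum fun x _ => ?_
  rw [mul_left_comm, ← integral_const_mul, ENNReal.ofReal_mul (hw0 x),
    ofReal_integral_eq_lintegral_ofReal (hsq.integrable _) (ae_of_all _ h0)]
  gcongr with z
  exact hpt z

lemma ofReal_le_minimaxRisk {d n m : ℕ} {D ε : ℝ} (hd : 1 ≤ d) (hn : 1 ≤ n) (hm : 1 ≤ m)
    (hD : 0 < D) (hε : 0 < ε) (𝒵 : Type*) [MeasurableSpace 𝒵] :
    ENNReal.ofReal (1 / 54 * min (D ^ 2 * (d : ℝ) ^ 2 / ((n : ℝ) * (m : ℝ) * min (ε ^ 2) ε))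
      (D ^ 2 * (d : ℝ))) ≤ minimaxRisk d D n m ε 𝒵 := by
  refine le_iInf fun est => le_iInf fun hest => le_iInf fun M => le_iInf fun hM => ?_
  have hC : ∀ l, BddMeasurable fun z => clip (est z l / D) := fun l =>
    ⟨by unfold clip; fun_prop, 1, fun z => abs_clip_le _⟩
  obtain ⟨θ, hθ, hle⟩ := M.exists_sq_le_mul_risk hε hm hM (fun a j => signPoint hD (a j)) hC
  have hP := isProbabilityMeasure_signLaw hD hθ
  refine le_trans ?_ (le_iSup
    (fun P : ProbabilityMeasure (linftyBall d D) => mse est M (P : Measure (linftyBall d D)))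
    ⟨signLaw hD θ, hP⟩)
  refine le_trans (ENNReal.ofReal_le_ofReal ?_) (ofReal_le_mse_signLaw hD hθ M hest hC)
  have hd0 : (0 : ℝ) < d := by exact_mod_cast hd
  have hn0 : (0 : ℝ) < n := by exact_mod_cast hn
  have hm0 : (0 : ℝ) < m := by exact_mod_cast hm
  have hK : 0 < (n : ℝ) * m * min (ε ^ 2) ε := by positivity
  have hR := min_div_le_of_sq_le hd0 hK (Finset.sum_nonneg fun x _ => mul_nonneg
    (Finset.prod_nonneg fun _ _ => (isSubgaussianScore_sampleScore hθ).nonneg _)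
    (integral_nonneg fun z => Finset.sum_nonneg fun _ _ => sq_nonneg _)) hle
  rw [mul_div_assoc, ← mul_min_of_nonneg _ _ (sq_nonneg D)]
  have := mul_le_mul_of_nonneg_left hR (sq_nonneg D)
  linarith

end UserLDP

theorem theorem7 :
    ∃ c : ℝ, 0 < c ∧
      ∀ (d n m : ℕ) (D ε : ℝ) (𝒵 : Type*) [MeasurableSpace 𝒵],
        1 ≤ d → 1 ≤ n → 1 ≤ m → 0 < D → 0 < ε →
          ENNReal.ofReal
              (c * min (D ^ 2 * (d : ℝ) ^ 2 / ((n : ℝ) * (m : ℝ) * min (ε ^ 2) ε))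
                (D ^ 2 * (d : ℝ))) ≤
            UserLDP.minimaxRisk d D n m ε 𝒵 := by
  exact ⟨1 / 54, by norm_num, fun d n m D ε 𝒵 _ hd hn hm hD hε =>
    UserLDP.ofReal_le_minimaxRisk hd hn hm hD hε 𝒵⟩
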